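/- **Conventions.** $X$ denotes a topological space and $\simeq$ denotes path-homotopy (homotopy relative to endpoints). A loop based at $x$ is non-trivial if it is not path-homotopic to the constant loop at $x$. The *algebraic 1-wild set* $\mathbf{aw}(X)\subseteq X$ is the set of all $x\in X$ for which there is a sequence $(\alpha_n)_{n\in\mathbb N}$ of non-trivial loops based at $x$ such that every neighborhood of $x$ contains $\alpha_n([0,1])$ for all but finitely many $n$. A space is *scattered* if each of its non-empty subspaces has an isolated point. For paths $\alpha,\beta:[0,1]\to X$, a *homotopy cut-set* for $\alpha$ and $\beta$ is a closed, nowhere dense set $A\subseteq[0,1]$ containing $0$ and $1$ such that $\alpha|_A=\beta|_A$ and such that $\alpha|_{[a,b]}\simeq\beta|_{[a,b]}$ for every connected component $(a,b)$ of $[0,1]\setminus A$. - $X$ has *well-defined transfinite $\pi_1$-products* if for every $x\in X$, any two loops $\alpha,\beta$ based at $x$ that admit a homotopy cut-set $A$ with $\alpha(A)=\beta(A)=\{x\}$ satisfy $\alpha\simeq\beta$. - $X$ has *well-defined transfinite $\Pi_1$-products* if any two paths $\alpha,\beta:[0,1]\to X$ that admit a homotopy cut-set satisfy $\alpha\simeq\beta$.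 **Theorem 1.1.** Let $X$ be any topological space such that $\mathbf{aw}(X)$, with the subspace topology, is scattered. Then $X$ has well-defined transfinite $\pi_1$-products if and only if $X$ has well-defined transfinite $\Pi_1$-products. -/

import Mathlib

open Set Filter Topology unitInterval

/-- A subset `S` of a topological space is scattered if every non-empty subset `T` of `S`
has a point that is isolated in the subspace `T`. -/
def IsScattered {X : Type*} [TopologicalSpace X] (S : Set X) : Prop :=
  ∀ T ⊆ S, T.Nonempty → ∃ t ∈ T, ∃ U : Set X, IsOpen U ∧ U ∩ T = {t}

/-- A sequence of loops based at `x` is null (converges to `x`) if every neighborhood of `x`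
contains the images of all but finitely many of the loops. -/
def IsNullLoopSequence {X : Type*} [TopologicalSpace X] {x : X} (l : ℕ → Path x x) : Prop :=
  ∀ U ∈ 𝓝 x, ∀ᶠ n in atTop, range (l n) ⊆ U

/-- The algebraic 1-wild set `aw(X)`: the points `x` at which there is a null sequence of
non-trivial loops (not path-homotopic to the constant loop at `x`). -/
def algebraicWildSet (X : Type*) [TopologicalSpace X] : Set X :=
  {x | ∃ l : ℕ → Path x x, IsNullLoopSequence l ∧ ∀ n, ¬ (l n).Homotopic (Path.refl x)}

/-- The connected components of the complement of `A` in `[0,1]`. -/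
def complementComponents (A : Set I) : Set (Set I) :=
  {J | ∃ t ∈ Aᶜ, J = connectedComponentIn Aᶜ t}

/-- `A` is a homotopy cut-set for the paths `α` and `β`: a closed nowhere dense subset of `[0,1]`
containing `0` and `1`, on which `α` and `β` agree, such that for every component `(a, b)` of
`[0,1] \ A` (its endpoints `a`, `b` lie in `A`) the restrictions of `α` and `β` to `[a, b]`
are path-homotopic. Restrictions are reparametrized linearly over `[0,1]`. -/
structure IsHomotopyCutSet {X : Type*} [TopologicalSpace X] {x y : X} (α β : Path x y)
    (A : Set I) : Prop where
  isClosed : IsClosed A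
  isNowhereDense : IsNowhereDense A
  zero_mem : (0 : I) ∈ A
  one_mem : (1 : I) ∈ A
  eq_on : ∀ t ∈ A, α t = β t
  homotopic : ∀ (a b : I) (ha : a ∈ A) (hb : b ∈ A), Ioo a b ∈ complementComponents A →
    (α.subpath a b).Homotopic ((β.subpath a b).cast (eq_on a ha) (eq_on b hb))

/-- Well-defined transfinite `π₁`-products at `x`: any two loops at `x` that admit a homotopy
cut-set which both of them map to `x` are path-homotopic. -/
def HasTransfinitePi1ProductsAt {X : Type*} [TopologicalSpace X] (x : X) : Prop :=
  ∀ (α β : Path x x) (A : Set I), (∀ t ∈ A, α t = x) → (∀ t ∈ A, β t = x) →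
    IsHomotopyCutSet α β A → α.Homotopic β

/-- Well-defined transfinite `π₁`-products (fundamental group operations). -/
def HasTransfinitePi1Products (X : Type*) [TopologicalSpace X] : Prop :=
  ∀ x : X, HasTransfinitePi1ProductsAt x

/-- Well-defined transfinite `Π₁`-products (fundamental groupoid operations): any two paths that
admit a homotopy cut-set are path-homotopic. Such paths have the same endpoints, since `0` and `1`
belong to the cut-set. -/
def HasTransfiniteGroupoidProducts (X : Type*) [TopologicalSpace X] : Prop :=
  ∀ (x y : X) (α β : Path x y) (A : Set I), IsHomotopyCutSet α β A → α.Homotopic β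

/-! Only the implication from loops to paths has content. Given a cut-set `A` for `α` and `β`,
relate two points of `A` when the restrictions of the paths between them are homotopic; the goal is
to relate 0 to 1.

Relation classes are closed. If `s n → t` within one class, the loops along `α` from `t` to `s n`
and back along `β` are all homotopic and shrink to `α t`. An Eilenberg swindle makes them trivial:
an infinite concatenation is homotopic to its own tail, which cancels
(`HasTransfinitePi1ProductsAt.homotopic_refl`).

Let `B` be the closed set of points of `A` whose class is not a neighborhood within `A`. Then `α`
maps `B` into the wild set, and an order argument (`rel_of_forall_mem_Ioo`) relates the two ends of
every gap of `B`. If `B` is non-empty, scatteredness isolates some `α t` in `α '' B`. Near `t` the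
set `B` is mapped to one point, so it serves as a cut-set for loops and the `π₁` hypothesis applies;
this puts `t` outside `B`, a contradiction. -/

/-- `α` and `β` agree at `s` and `t`, and their restrictions to the interval between `s` and `t`
are path-homotopic. -/
def Path.HomotopicBetween {X : Type*} [TopologicalSpace X] {x y : X} (α β : Path x y)
    (s t : I) : Prop :=
  ∃ (h₁ : α s = β s) (h₂ : α t = β t),
    (α.subpath s t).Homotopic ((β.subpath s t).cast h₁ h₂)

namespace Path.HomotopicBetween

variable {X : Type*} [TopologicalSpace X] {x y : X} {α β : Path x y} {s t u : I}

lemma refl (h : α s = β s) : α.HomotopicBetween β s s := by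
  refine ⟨h, h, ?_⟩
  have : (β.subpath s s).cast h h = α.subpath s s := by
    ext r
    simp [h]
  rw [this]

lemma symm (h : α.HomotopicBetween β s t) : α.HomotopicBetween β t s := by
  obtain ⟨h₁, h₂, H⟩ := h
  refine ⟨h₂, h₁, ?_⟩
  have := H.symm₂
  rw [symm_subpath] at this
  rwa [← symm_subpath β]

/-- Free endpoints `a`, `b`, `c` let `subst` remove the casts. -/
lemma subpath_trans_subpath_cast (β : Path x y) {a b c : X} (s t u : I) (ha : a = β s)
    (hb : b = β t) (hc : c = β u) :
    (((β.subpath s t).cast ha hb).trans ((β.subpath t u).cast hb hc)).Homotopic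
      ((β.subpath s u).cast ha hc) := by
  subst ha hb hc
  exact ⟨Homotopy.subpathTransSubpath β s t u⟩

lemma trans (h : α.HomotopicBetween β s t) (h' : α.HomotopicBetween β t u) :
    α.HomotopicBetween β s u := by
  obtain ⟨h₁, h₂, H⟩ := h
  obtain ⟨_, h₃, H'⟩ := h'
  refine ⟨h₁, h₃, ?_⟩
  have e : ((α.subpath s t).trans (α.subpath t u)).Homotopic (α.subpath s u) :=
    ⟨Homotopy.subpathTransSubpath α s t u⟩
  exact e.symm.trans ((H.hcomp H').trans (subpath_trans_subpath_cast β s t u h₁ h₂ h₃))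

lemma homotopic (h : α.HomotopicBetween β 0 1) : α.Homotopic β := by
  obtain ⟨h₁, h₂, H⟩ := h
  have := H.pathCast α.source.symm α.target.symm
  convert this using 1
  · ext r; simp
  · ext r; simp

end Path.HomotopicBetween

/-! ### Gaps of a cut-set in terms of the order -/

section CutSet

variable {X : Type*} [TopologicalSpace X] {x y : X} {α β : Path x y} {A : Set I}

lemma Ioo_mem_complementComponents {a b : I} (ha : a ∈ A) (hb : b ∈ A) (hab : a < b)
    (h : Disjoint (Ioo a b) A) : Ioo a b ∈ complementComponents A := by
  obtain ⟨t, ht⟩ := exists_between hab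
  refine ⟨t, disjoint_left.1 h ht, Subset.antisymm ?_ ?_⟩
  · exact isPreconnected_Ioo.subset_connectedComponentIn ht (disjoint_left.1 h)
  · intro u hu
    have hc : (connectedComponentIn Aᶜ t).OrdConnected :=
      isPreconnected_connectedComponentIn.ordConnected
    have hsub : connectedComponentIn Aᶜ t ⊆ Aᶜ := connectedComponentIn_subset _ _
    have htm : t ∈ connectedComponentIn Aᶜ t := mem_connectedComponentIn (disjoint_left.1 h ht)
    refine ⟨?_, ?_⟩
    · by_contra! hle
      exact hsub (hc.out hu htm ⟨hle, ht.1.le⟩) ha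
    · by_contra! hle
      exact hsub (hc.out htm hu ⟨ht.2.le, hle⟩) hb

lemma lt_of_Ioo_mem_complementComponents {a b : I} (h : Ioo a b ∈ complementComponents A) :
    a < b ∧ Disjoint (Ioo a b) A := by
  obtain ⟨t, ht, e⟩ := h
  have htm : t ∈ Ioo a b := e ▸ mem_connectedComponentIn ht
  refine ⟨htm.1.trans htm.2, disjoint_left.2 fun u hu => ?_⟩
  rw [e] at hu
  exact connectedComponentIn_subset _ _ hu

lemma IsHomotopyCutSet.homotopicBetween (hA : IsHomotopyCutSet α β A) {a b : I} (ha : a ∈ A)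
    (hb : b ∈ A) (hab : a < b) (h : Disjoint (Ioo a b) A) : α.HomotopicBetween β a b :=
  ⟨_, _, hA.homotopic a b ha hb (Ioo_mem_complementComponents ha hb hab h)⟩

lemma IsHomotopyCutSet.exists_between_notMem (hA : IsHomotopyCutSet α β A) {c d : I}
    (hcd : c < d) : ∃ u ∉ A, c < u ∧ u < d := by
  have := (isClosed_isNowhereDense_iff_compl.1 ⟨hA.isClosed, hA.isNowhereDense⟩).2
  obtain ⟨u, hu, h⟩ := dense_iff_exists_between.1 this c d hcd
  exact ⟨u, hu, h.1, h.2⟩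

lemma IsHomotopyCutSet.of_homotopicBetween (hc : IsClosed A)
    (hd : ∀ c d : I, c < d → ∃ u ∉ A, c < u ∧ u < d) (h0 : 0 ∈ A) (h1 : 1 ∈ A)
    (he : ∀ t ∈ A, α t = β t)
    (h : ∀ a ∈ A, ∀ b ∈ A, a < b → Disjoint (Ioo a b) A → α.HomotopicBetween β a b) :
    IsHomotopyCutSet α β A where
  isClosed := hc
  isNowhereDense := by
    refine (isClosed_isNowhereDense_iff_compl.2 ⟨hc.isOpen_compl, ?_⟩).2
    rw [dense_iff_exists_between]
    intro c d hcd
    obtain ⟨u, hu, h⟩ := hd c d hcd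
    exact ⟨u, hu, h⟩
  zero_mem := h0
  one_mem := h1
  eq_on := he
  homotopic a b ha hb hJ := by
    obtain ⟨hab, hdis⟩ := lt_of_Ioo_mem_complementComponents hJ
    exact (h a ha b hb hab hdis).2.2

end CutSet

/-! ### Propagating a relation along a closed subset of a compact linear order -/

section OrderLemma

/-- In a compact linear order, let `r` be a transitive relation on a closed set `A` that relates
the ends of each gap of `A` and whose classes are closed. Then it relates `s` to `q` whenever each
point of `A ∩ [s, q)` is related to all nearby points of `A`. -/
lemma rel_of_forall_mem_Ico {L : Type*} [LinearOrder L] [TopologicalSpace L] [OrderTopology L]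
    [CompactSpace L] {A : Set L} {r : L → L → Prop} (hA : IsClosed A)
    (htrans : ∀ a b c, r a b → r b c → r a c)
    (hgap : ∀ a ∈ A, ∀ b ∈ A, a < b → Disjoint (Ioo a b) A → r a b)
    (hcl : ∀ s ∈ A, IsClosed {t ∈ A | r s t}) {s q : L} (hs : s ∈ A) (hq : q ∈ A) (hsq : s < q)
    (hrefl : r s s) (hgood : ∀ m ∈ A, s ≤ m → m < q → ∀ᶠ u in 𝓝 m, u ∈ A → r m u) : r s q := by
  have hK : IsCompact ({t ∈ A | r s t} ∩ Icc s q) := ((hcl s hs).inter isClosed_Icc).isCompact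
  obtain ⟨m, ⟨⟨hmA, hsm⟩, hm⟩, hmax⟩ := hK.exists_isGreatest ⟨s, ⟨hs, hrefl⟩, le_rfl, hsq.le⟩
  rcases hm.2.eq_or_lt with rfl | hmq
  · exact hsm
  obtain ⟨w, hw, hsub⟩ := (mem_nhdsGE_iff_exists_Ico_subset' hmq).1
    (mem_nhdsWithin_of_mem_nhds (hgood m hmA hm.1 hmq))
  rcases le_or_gt w q with hwq | hwq
  -- `(m, m')` is a gap of `A`: a point of `A` below `w` would contradict the maximality of `m`, one
  -- from `w` on the minimality of `m'`.
  · obtain ⟨m', ⟨hm'A, hm'⟩, hmin⟩ := (hA.inter isClosed_Icc).isCompact.exists_isLeast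
      (s := A ∩ Icc w q) ⟨q, hq, hwq, le_rfl⟩
    have hmm' : m < m' := lt_of_lt_of_le hw hm'.1
    have hr : r m m' := by
      refine hgap m hmA m' hm'A hmm' (disjoint_left.2 fun u hu huA => ?_)
      rcases lt_or_ge u w with huw | huw
      · exact (hmax ⟨⟨huA, htrans _ _ _ hsm (hsub ⟨hu.1.le, huw⟩ huA)⟩, hm.1.trans hu.1.le,
          hu.2.le.trans hm'.2⟩).not_gt hu.1
      · exact (hmin ⟨huA, huw, hu.2.le.trans hm'.2⟩).not_gt hu.2
    exact absurd (hmax ⟨⟨hm'A, htrans _ _ _ hsm hr⟩, hm.1.trans hmm'.le, hm'.2⟩) hmm'.not_ge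
  · exact htrans _ _ _ hsm (hsub ⟨hmq.le, hwq⟩ hq)

/-- Start at a point of `A` inside `(p, q)` and move right, then left in the order dual. The ends
need not be good: closed classes reach them. -/
lemma rel_of_forall_mem_Ioo {L : Type*} [LinearOrder L] [TopologicalSpace L] [OrderTopology L]
    [CompactSpace L] {A : Set L} {r : L → L → Prop} (hA : IsClosed A)
    (hrefl : ∀ a ∈ A, r a a) (hsymm : ∀ a b, r a b → r b a)
    (htrans : ∀ a b c, r a b → r b c → r a c)
    (hgap : ∀ a ∈ A, ∀ b ∈ A, a < b → Disjoint (Ioo a b) A → r a b)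
    (hcl : ∀ s ∈ A, IsClosed {t ∈ A | r s t}) {p q : L} (hp : p ∈ A) (hq : q ∈ A) (hpq : p < q)
    (hgood : ∀ m ∈ A, p < m → m < q → ∀ᶠ u in 𝓝 m, u ∈ A → r m u) : r p q := by
  by_cases hdis : Disjoint (Ioo p q) A
  · exact hgap p hp q hq hpq hdis
  obtain ⟨s, hsI, hsA⟩ := not_disjoint_iff.1 hdis
  have hr : r s q := rel_of_forall_mem_Ico hA htrans hgap hcl hsA hq hsI.2 (hrefl s hsA)
    fun m hm h1 h2 => hgood m hm (hsI.1.trans_le h1) h2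
  have hl : r s p := by
    have : CompactSpace Lᵒᵈ := ‹CompactSpace L›
    refine rel_of_forall_mem_Ico (L := Lᵒᵈ) (A := A) (r := r) hA htrans ?_ hcl hsA hp hsI.1
      (hrefl s hsA) fun m hm h1 h2 => hgood m hm h2 (lt_of_le_of_lt h1 hsI.2)
    intro a ha b hb hab hd
    refine hsymm _ _ (hgap b hb a ha hab (disjoint_left.2 fun u hu => ?_))
    exact hd.notMem_of_mem_left (a := u) ⟨hu.2, hu.1⟩
  exact htrans _ _ _ (hsymm _ _ hl) hr

end OrderLemma

/-! ### Infinite concatenations and the swindle -/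

section InfiniteConcatenation

variable {X : Type*} [TopologicalSpace X] {x : X}

open Classical in
/-- The function underlying the infinite concatenation `⋯ * l 2 * l 1 * l 0`: the loop `l n` is
traversed on `[2⁻⁽ⁿ⁺¹⁾, 2⁻ⁿ]`. -/
noncomputable def infiniteConcatFun (l : ℕ → Path x x) (t : ℝ) : X :=
  if h : ∃ n : ℕ, (1 / 2 : ℝ) ^ (n + 1) < t then
    (l (Nat.find h)).extend (2 ^ (Nat.find h + 1) * t - 1)
  else x

lemma infiniteConcatFun_of_nonpos (l : ℕ → Path x x) {t : ℝ} (ht : t ≤ 0) :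
    infiniteConcatFun l t = x := by
  rw [infiniteConcatFun, dif_neg]
  rintro ⟨n, hn⟩
  exact absurd (hn.trans_le ht) (by positivity : (0 : ℝ) < (1 / 2) ^ (n + 1)).not_gt

lemma infiniteConcatFun_of_lt (l : ℕ → Path x x) {t : ℝ} {n : ℕ}
    (h₁ : (1 / 2 : ℝ) ^ (n + 1) < t) (h₂ : t ≤ (1 / 2) ^ n) :
    infiniteConcatFun l t = (l n).extend (2 ^ (n + 1) * t - 1) := by
  have h : ∃ n : ℕ, (1 / 2 : ℝ) ^ (n + 1) < t := ⟨n, h₁⟩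
  have e : Nat.find h = n := by
    rw [Nat.find_eq_iff]
    refine ⟨h₁, fun m hm => not_lt.2 (h₂.trans ?_)⟩
    exact pow_le_pow_of_le_one (by norm_num) (by norm_num) hm
  rw [infiniteConcatFun, dif_pos h, e]

lemma infiniteConcatFun_of_one_lt (l : ℕ → Path x x) {t : ℝ} (ht : 1 < t) :
    infiniteConcatFun l t = x := by
  have h : ∃ n : ℕ, (1 / 2 : ℝ) ^ (n + 1) < t := ⟨0, by linarith⟩
  have e : Nat.find h = 0 := by
    rw [Nat.find_eq_zero]
    linarith
  rw [infiniteConcatFun, dif_pos h, e, Path.extend_of_one_le _ (by norm_num; linarith)]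

lemma infiniteConcatFun_of_le (l : ℕ → Path x x) {t : ℝ} {n : ℕ}
    (h₁ : (1 / 2 : ℝ) ^ (n + 1) ≤ t) (h₂ : t ≤ (1 / 2) ^ n) :
    infiniteConcatFun l t = (l n).extend (2 ^ (n + 1) * t - 1) := by
  rcases h₁.lt_or_eq with h | rfl
  · exact infiniteConcatFun_of_lt l h h₂
  -- At the left end the definition selects the loop of index `n + 1`, at its final point; both
  -- loops give `x` there.
  · have h3 : (1 / 2 : ℝ) ^ (n + 1 + 1) < (1 / 2) ^ (n + 1) :=
      pow_lt_pow_right_of_lt_one₀ (by norm_num) (by norm_num) (Nat.lt_succ_self _)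
    rw [infiniteConcatFun_of_lt l h3 le_rfl, Path.extend_of_one_le, Path.extend_of_le_zero]
    · rw [← mul_pow]; norm_num
    · rw [pow_succ (2 : ℝ) (n + 1), mul_right_comm, ← mul_pow]; norm_num

lemma exists_infiniteConcatFun_eq (l : ℕ → Path x x) {t : ℝ} (h₀ : 0 < t) (h₁ : t ≤ 1) :
    ∃ n : ℕ, (1 / 2 : ℝ) ^ (n + 1) < t ∧ t ≤ (1 / 2) ^ n ∧
      infiniteConcatFun l t = (l n).extend (2 ^ (n + 1) * t - 1) := by
  obtain ⟨n, h, h'⟩ := exists_nat_pow_near_of_lt_one (y := (1 / 2 : ℝ)) h₀ h₁ (by norm_num)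
    (by norm_num)
  exact ⟨n, h, h', infiniteConcatFun_of_lt l h h'⟩

lemma continuousOn_infiniteConcatFun_Ici (l : ℕ → Path x x) (n : ℕ) :
    ContinuousOn (infiniteConcatFun l) (Ici ((1 / 2 : ℝ) ^ n)) := by
  induction n with
  | zero =>
    refine (continuousOn_const (c := x)).congr fun t ht => ?_
    rw [mem_Ici, pow_zero] at ht
    rcases ht.lt_or_eq with h | rfl
    · exact infiniteConcatFun_of_one_lt l h
    · rw [infiniteConcatFun_of_le l (n := 0) (by norm_num) (by norm_num), Path.extend_of_one_le]
      norm_num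
  | succ n ih =>
    have hle : (1 / 2 : ℝ) ^ (n + 1) ≤ (1 / 2) ^ n :=
      pow_le_pow_of_le_one (by norm_num) (by norm_num) n.le_succ
    rw [← Icc_union_Ici_eq_Ici hle]
    refine ContinuousOn.union_of_isClosed ?_ ih isClosed_Icc isClosed_Ici
    have : Continuous fun t : ℝ => (l n).extend (2 ^ (n + 1) * t - 1) := by fun_prop
    exact this.continuousOn.congr fun t ht => infiniteConcatFun_of_le l ht.1 ht.2

lemma continuous_infiniteConcatFun {l : ℕ → Path x x} (hl : IsNullLoopSequence l) :
    Continuous (infiniteConcatFun l) := by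
  rw [continuous_iff_continuousAt]
  intro t
  rcases le_or_gt t 0 with ht | ht
  · rw [ContinuousAt, infiniteConcatFun_of_nonpos l ht]
    -- Continuity at 0 is where nullness enters: small times only see loops of large index.
    refine fun U hU => mem_map.2 ?_
    obtain ⟨N, hN⟩ := eventually_atTop.1 (hl U hU)
    have hpos : (0 : ℝ) < (1 / 2) ^ N := by positivity
    filter_upwards [Iio_mem_nhds (ht.trans_lt hpos)] with s hs
    rcases le_or_gt s 0 with hs0 | hs0
    · rw [mem_preimage, infiniteConcatFun_of_nonpos l hs0]
      exact mem_of_mem_nhds hU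
    · have hs1 : s ≤ 1 := hs.le.trans (pow_le_one₀ (by norm_num) (by norm_num))
      obtain ⟨n, h₁, h₂, h₃⟩ := exists_infiniteConcatFun_eq l hs0 hs1
      have hn : N ≤ n := by
        have := (pow_lt_pow_iff_right_of_lt_one₀ (by norm_num) (by norm_num)).1 (h₁.trans hs)
        omega
      rw [mem_preimage, h₃]
      apply hN n hn
      rw [← Path.extend_range]
      exact mem_range_self _
  · obtain ⟨n, hn⟩ := exists_pow_lt_of_lt_one ht (by norm_num : (1 / 2 : ℝ) < 1)
    exact (continuousOn_infiniteConcatFun_Ici l n).continuousAt (Ici_mem_nhds hn)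

/-- The infinite concatenation `⋯ * l 2 * l 1 * l 0` of a null sequence of loops. -/
noncomputable def infiniteConcat (l : ℕ → Path x x) (hl : IsNullLoopSequence l) : Path x x where
  toFun t := infiniteConcatFun l t
  continuous_toFun := (continuous_infiniteConcatFun hl).comp continuous_subtype_val
  source' := infiniteConcatFun_of_nonpos l (by simp)
  target' := by
    rw [infiniteConcatFun_of_le l (n := 0) (by norm_num) (by norm_num), Path.extend_of_one_le]
    norm_num

lemma infiniteConcat_apply (l : ℕ → Path x x) (hl : IsNullLoopSequence l) (t : I) :
    infiniteConcat l hl t = infiniteConcatFun l t := rfl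

lemma IsNullLoopSequence.shift {l : ℕ → Path x x} (hl : IsNullLoopSequence l) :
    IsNullLoopSequence fun n => l (n + 1) :=
  fun U hU => (tendsto_add_atTop_nat 1).eventually (hl U hU)

lemma infiniteConcat_eq_trans (l : ℕ → Path x x) (hl : IsNullLoopSequence l) :
    infiniteConcat l hl = (infiniteConcat (fun n => l (n + 1)) hl.shift).trans (l 0) := by
  ext t
  rw [Path.trans_apply, infiniteConcat_apply]
  split_ifs with h
  · rw [infiniteConcat_apply]
    rcases t.2.1.eq_or_lt with h0 | h0
    · rw [infiniteConcatFun_of_nonpos l h0.ge, infiniteConcatFun_of_nonpos _ (by simp [← h0])]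
    · obtain ⟨n, h₁, h₂, h₃⟩ := exists_infiniteConcatFun_eq (fun n => l (n + 1))
        (t := 2 * (t : ℝ)) (by linarith) (by linarith)
      simp only [h₃]
      rw [infiniteConcatFun_of_le l (n := n + 1)]
      · congr 1
        ring
      · rw [pow_succ]; linarith
      · rw [pow_succ]; linarith
  · rw [infiniteConcatFun_of_le l (n := 0) (by linarith) (by simpa using t.2.2)]
    rw [Path.extend_apply _ ⟨by norm_num; linarith, by norm_num; linarith [t.2.2]⟩]
    simp

/-- The points `2⁻ⁿ` of the unit interval. -/
noncomputable def halfPow (n : ℕ) : I :=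
  ⟨(1 / 2) ^ n, by positivity, pow_le_one₀ (by norm_num) (by norm_num)⟩

lemma coe_halfPow (n : ℕ) : (halfPow n : ℝ) = (1 / 2) ^ n := rfl

lemma halfPow_lt_iff {m n : ℕ} : halfPow m < halfPow n ↔ n < m := by
  rw [← Subtype.coe_lt_coe, coe_halfPow, coe_halfPow]
  exact pow_lt_pow_iff_right_of_lt_one₀ (by norm_num) (by norm_num)

lemma tendsto_halfPow : Tendsto halfPow atTop (𝓝 0) := by
  rw [tendsto_subtype_rng]
  exact tendsto_pow_atTop_nhds_zero_of_lt_one (by norm_num) (by norm_num)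

lemma exists_eq_halfPow_of_disjoint {a b : I} (ha : a ∈ insert 0 (range halfPow))
    (hb : b ∈ insert 0 (range halfPow)) (hab : a < b)
    (h : Disjoint (Ioo a b) (insert 0 (range halfPow))) :
    ∃ n, a = halfPow (n + 1) ∧ b = halfPow n := by
  rcases hb with rfl | ⟨n, rfl⟩
  · exact absurd hab (not_lt.2 a.2.1)
  have hle : halfPow (n + 1) ≤ a := by
    by_contra! hlt
    exact disjoint_left.1 h ⟨hlt, halfPow_lt_iff.2 n.lt_succ_self⟩ (Or.inr ⟨_, rfl⟩)
  rcases ha with rfl | ⟨m, rfl⟩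
  · have : (0 : ℝ) < (1 / 2) ^ (n + 1) := by positivity
    exact absurd hle (not_le.2 this)
  · have h1 := halfPow_lt_iff.1 hab
    have h2 := not_lt.1 (mt halfPow_lt_iff.2 (not_lt.2 hle))
    obtain rfl : m = n + 1 := by omega
    exact ⟨n, rfl, rfl⟩

lemma exists_notMem_of_countable {A : Set I} (hA : A.Countable) {c d : I} (hcd : c < d) :
    ∃ u ∉ A, c < u ∧ u < d := by
  by_contra! H
  refine (not_le.2 hcd) (Cardinal.Real.Ioo_countable_iff.1 ((hA.image ((↑) : I → ℝ)).mono fun u hu => ?_))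
  have hu' : u ∈ I := ⟨c.2.1.trans hu.1.le, hu.2.le.trans d.2.2⟩
  refine ⟨⟨u, hu'⟩, ?_, rfl⟩
  by_contra hn
  exact (H ⟨u, hu'⟩ hn hu.1).not_gt hu.2

lemma infiniteConcat_halfPow (l : ℕ → Path x x) (hl : IsNullLoopSequence l) (n : ℕ) :
    infiniteConcat l hl (halfPow n) = x := by
  rw [infiniteConcat_apply, infiniteConcatFun_of_le l (n := n), Path.extend_of_one_le]
  · rw [coe_halfPow, pow_succ, mul_right_comm, ← mul_pow]; norm_num
  · exact pow_le_pow_of_le_one (by norm_num) (by norm_num) n.le_succ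
  · exact le_rfl

lemma infiniteConcat_subpath (l : ℕ → Path x x) (hl : IsNullLoopSequence l) (n : ℕ) :
    (infiniteConcat l hl).subpath (halfPow (n + 1)) (halfPow n) =
      (l n).cast (infiniteConcat_halfPow l hl _) (infiniteConcat_halfPow l hl _) := by
  ext s
  change infiniteConcatFun l (Icc.convexComb (halfPow (n + 1)) (halfPow n) s : I) = l n s
  have e : ((Icc.convexComb (halfPow (n + 1)) (halfPow n) s : I) : ℝ) =
      (1 / 2) ^ (n + 1) * (1 + s) := by
    rw [Icc.coe_convexComb, coe_halfPow, coe_halfPow, pow_succ]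
    ring
  have hp : (0 : ℝ) < (1 / 2) ^ (n + 1) := by positivity
  rw [e, infiniteConcatFun_of_le l (n := n)]
  · rw [← mul_assoc, ← mul_pow]
    norm_num
  · nlinarith [s.2.1]
  · have : (1 / 2 : ℝ) ^ n = (1 / 2) ^ (n + 1) * 2 := by rw [pow_succ]; ring
    nlinarith [s.2.2]

lemma HasTransfinitePi1ProductsAt.infiniteConcat_homotopic (hx : HasTransfinitePi1ProductsAt x)
    {l l' : ℕ → Path x x} (hl : IsNullLoopSequence l) (hl' : IsNullLoopSequence l')
    (h : ∀ n, (l n).Homotopic (l' n)) :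
    (infiniteConcat l hl).Homotopic (infiniteConcat l' hl') := by
  have hval (l : ℕ → Path x x) (hl : IsNullLoopSequence l) :
      ∀ t ∈ insert 0 (range halfPow), infiniteConcat l hl t = x := by
    rintro t (rfl | ⟨n, rfl⟩)
    · exact Path.source _
    · exact infiniteConcat_halfPow l hl n
  refine hx _ _ (insert 0 (range halfPow)) (hval l hl) (hval l' hl')
    (IsHomotopyCutSet.of_homotopicBetween tendsto_halfPow.isCompact_insert_range.isClosed
      (fun c d => exists_notMem_of_countable ((countable_range _).insert _)) (Or.inl rfl)
      (Or.inr ⟨0, by ext; simp [coe_halfPow]⟩)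
      (fun t ht => (hval l hl t ht).trans (hval l' hl' t ht).symm) ?_)
  intro a ha b hb hab hd
  obtain ⟨n, rfl, rfl⟩ := exists_eq_halfPow_of_disjoint ha hb hab hd
  refine ⟨(hval l hl _ ha).trans (hval l' hl' _ ha).symm,
    (hval l hl _ hb).trans (hval l' hl' _ hb).symm, ?_⟩
  rw [infiniteConcat_subpath, infiniteConcat_subpath]
  exact (h n).pathCast _ _

/-- Under well-defined transfinite `π₁`-products at `x`, a homotopy class with arbitrarily small
representatives along a null sequence is trivial. -/
lemma HasTransfinitePi1ProductsAt.homotopic_refl (hx : HasTransfinitePi1ProductsAt x)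
    {l : ℕ → Path x x} (hl : IsNullLoopSequence l) (h : ∀ n, (l n).Homotopic (l (n + 1))) :
    (l 0).Homotopic (Path.refl x) := by
  -- With `Q` the shifted concatenation, this reads `Q * l 0 ≃ Q`; cancel `Q` on the left.
  have H := hx.infiniteConcat_homotopic hl hl.shift h
  rw [infiniteConcat_eq_trans] at H
  set Q := infiniteConcat (fun n => l (n + 1)) hl.shift
  rw [← Path.Homotopic.Quotient.eq] at H ⊢
  rw [Path.Homotopic.Quotient.mk_trans] at H
  have := congrArg (Path.Homotopic.Quotient.trans (Path.Homotopic.Quotient.mk Q).symm) H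
  rwa [← Path.Homotopic.Quotient.trans_assoc, Path.Homotopic.Quotient.symm_trans,
    Path.Homotopic.Quotient.refl_trans] at this

end InfiniteConcatenation

/-! ### Comparison loops: closed classes and tame points -/

section ComparisonLoop

variable {X : Type*} [TopologicalSpace X] {x y : X} {α β : Path x y}

/-- The loop that follows `α` from `t` to `s` and then returns along `β`. -/
noncomputable def Path.comparisonLoop (α β : Path x y) {t s : I} (ht : α t = β t) (hs : α s = β s) :
    Path (α t) (α t) :=
  (α.subpath t s).trans ((β.subpath s t).cast hs ht)

lemma Path.homotopic_iff_trans_symm {a b : X} {p q : Path a b} :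
    p.Homotopic q ↔ (p.trans q.symm).Homotopic (Path.refl a) := by
  refine ⟨fun h => (h.hcomp (.refl _)).trans (.trans_symm q), fun h => ?_⟩
  rw [← Path.Homotopic.Quotient.eq] at h ⊢
  rw [Path.Homotopic.Quotient.mk_trans, Path.Homotopic.Quotient.mk_symm] at h
  have := congrArg (fun r => Path.Homotopic.Quotient.trans r (Path.Homotopic.Quotient.mk q)) h
  simpa using this

lemma Path.homotopicBetween_iff_comparisonLoop {t s : I} (ht : α t = β t) (hs : α s = β s) :
    α.HomotopicBetween β t s ↔ (α.comparisonLoop β ht hs).Homotopic (Path.refl _) := by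
  have e : (β.subpath s t).cast hs ht = ((β.subpath t s).cast ht hs).symm := by
    rw [← Path.symm_subpath β]
    rfl
  rw [Path.comparisonLoop, e, ← Path.homotopic_iff_trans_symm]
  exact ⟨fun h => h.2.2, fun h => ⟨ht, hs, h⟩⟩

/-- Route the return along `β` through `u`, replace its piece from `s` to `u` by that of `α`, and
merge this with the outgoing path. -/
lemma Path.HomotopicBetween.comparisonLoop_homotopic {t s u : I} (ht : α t = β t)
    (hs : α s = β s) (hu : α u = β u) (h : α.HomotopicBetween β s u) :
    (α.comparisonLoop β ht hs).Homotopic (α.comparisonLoop β ht hu) := by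
  have hβ := subpath_trans_subpath_cast β s u t hs hu ht
  have hα : ((α.subpath t s).trans (α.subpath s u)).Homotopic (α.subpath t u) :=
    ⟨Path.Homotopy.subpathTransSubpath α t s u⟩
  refine ((Path.Homotopic.refl _).hcomp hβ.symm).trans ?_
  refine ((Path.Homotopic.refl _).hcomp (h.2.2.symm.hcomp (.refl _))).trans ?_
  exact (Path.Homotopic.trans_assoc _ _ _).symm.trans (hα.hcomp (.refl _))

lemma Path.isNullLoopSequence_comparisonLoop {t : I} (ht : α t = β t) {s : ℕ → I}
    (hs : ∀ n, α (s n) = β (s n)) (hlim : Tendsto s atTop (𝓝 t)) :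
    IsNullLoopSequence fun n => α.comparisonLoop β ht (hs n) := by
  intro U hU
  have hα : α ⁻¹' U ∈ 𝓝 t := α.continuous.continuousAt hU
  have hβ : β ⁻¹' U ∈ 𝓝 t := β.continuous.continuousAt (ht ▸ hU)
  have hI : Tendsto (fun n => uIcc t (s n)) atTop (𝓝 t).smallSets :=
    tendsto_const_nhds.uIcc hlim
  filter_upwards [tendsto_smallSets_iff.1 hI _ (inter_mem hα hβ)] with n hn
  rw [Path.comparisonLoop, Path.trans_range, Path.cast_coe, Path.range_subpath,
    Path.range_subpath, uIcc_comm (s n) t]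
  exact union_subset (image_subset_iff.2 fun r hr => (hn hr).1)
    (image_subset_iff.2 fun r hr => (hn hr).2)

lemma HasTransfinitePi1Products.homotopicBetween_of_tendsto (hX : HasTransfinitePi1Products X)
    {t : I} (ht : α t = β t) {s : ℕ → I} (hlim : Tendsto s atTop (𝓝 t))
    (h : ∀ n, α.HomotopicBetween β (s n) (s (n + 1))) : α.HomotopicBetween β t (s 0) := by
  have hs : ∀ n, α (s n) = β (s n) := fun n => (h n).1
  exact (Path.homotopicBetween_iff_comparisonLoop ht (hs 0)).2
    ((hX (α t)).homotopic_refl (Path.isNullLoopSequence_comparisonLoop ht hs hlim)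
      fun n => (h n).comparisonLoop_homotopic ht (hs n) (hs (n + 1)))

lemma HasTransfinitePi1Products.isClosed_setOf_homotopicBetween
    (hX : HasTransfinitePi1Products X) {A : Set I} (hA : IsClosed A)
    (he : ∀ t ∈ A, α t = β t) (s : I) : IsClosed {t ∈ A | α.HomotopicBetween β s t} := by
  refine IsSeqClosed.isClosed fun u t hu hut => ?_
  have ht : t ∈ A := hA.mem_of_tendsto hut (.of_forall fun n => (hu n).1)
  refine ⟨ht, ((hu 0).2).trans (hX.homotopicBetween_of_tendsto (he t ht) hut fun n => ?_).symm⟩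
  exact (hu n).2.symm.trans (hu (n + 1)).2

/-- Otherwise unrelated points of `A` converging to `t` give a null sequence of non-trivial
comparison loops. -/
lemma eventually_homotopicBetween_of_notMem_algebraicWildSet {A : Set I}
    (he : ∀ t ∈ A, α t = β t) {t : I} (ht : t ∈ A) (hw : α t ∉ algebraicWildSet X) :
    ∀ᶠ u in 𝓝 t, u ∈ A → α.HomotopicBetween β t u := by
  by_contra H
  obtain ⟨s, hlim, hs⟩ := exists_seq_forall_of_frequently (not_eventually.1 H)
  simp only [Classical.not_imp] at hs
  refine hw ⟨fun n => α.comparisonLoop β (he t ht) (he _ (hs n).1),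
    Path.isNullLoopSequence_comparisonLoop _ _ hlim, fun n hn => (hs n).2 ?_⟩
  exact (Path.homotopicBetween_iff_comparisonLoop _ _).2 hn

end ComparisonLoop

/-! ### Removing the bad set by scatteredness -/

section Reduction

variable {X : Type*} [TopologicalSpace X] {x y : X} {α β : Path x y} {A : Set I}

/-- Paths that agree with a constant on a closed nowhere dense set `K ∩ [p, q]` containing `p` and
`q`, and that are homotopic over each gap of `K` in `[p, q]`, are homotopic over `[p, q]`. -/
lemma HasTransfinitePi1Products.homotopicBetween_of_const (hX : HasTransfinitePi1Products X)
    {K : Set I} (hK : IsClosed K) (hd : ∀ c d : I, c < d → ∃ u ∉ K, c < u ∧ u < d) {p q : I}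
    (hpq : p < q) (hp : p ∈ K) (hq : q ∈ K) (hα : ∀ t ∈ K, t ∈ Icc p q → α t = α p)
    (he : ∀ t ∈ K, α t = β t)
    (hgap : ∀ a ∈ K, ∀ b ∈ K, p ≤ a → a < b → b ≤ q → Disjoint (Ioo a b) K →
      α.HomotopicBetween β a b) : α.HomotopicBetween β p q := by
  set φ : I → I := Icc.convexComb p q with hφ
  have hφc : Continuous φ := Icc.continuous_convexComb p q
  have hφI : ∀ s, φ s ∈ Icc p q := fun s =>
    ⟨Icc.le_convexComb hpq.le s, Icc.convexComb_le hpq.le s⟩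
  have hφs : StrictMono φ := by
    intro s s' hs
    rw [← Subtype.coe_lt_coe] at hs hpq ⊢
    rw [hφ, Icc.coe_convexComb, Icc.coe_convexComb]
    nlinarith
  have hsurj : ∀ u ∈ Icc p q, ∃ s, φ s = u := fun u hu => by
    have : u ∈ range φ := by
      rw [hφ, Path.range_subpathAux, uIcc_of_le hpq.le]
      exact hu
    exact this
  have hqp : α q = α p := hα q hq ⟨hpq.le, le_rfl⟩
  let α' : Path (α p) (α p) := (α.subpath p q).cast rfl hqp.symm
  let β' : Path (α p) (α p) := (β.subpath p q).cast (he p hp) (hqp.symm.trans (he q hq))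
  refine ⟨he p hp, he q hq, ?_⟩
  suffices h : α'.Homotopic β' from h.pathCast rfl hqp
  refine hX (α p) α' β' (φ ⁻¹' K) (fun s hs => hα _ hs (hφI s))
    (fun s hs => (he _ hs).symm.trans (hα _ hs (hφI s)))
    (IsHomotopyCutSet.of_homotopicBetween (hK.preimage hφc) ?_ ?_ ?_ (fun s hs => he _ hs) ?_)
  · intro c d hcd
    obtain ⟨u, huK, hcu, hud⟩ := hd _ _ (hφs hcd)
    obtain ⟨s, rfl⟩ := hsurj u ⟨(hφI c).1.trans hcu.le, hud.le.trans (hφI d).2⟩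
    exact ⟨s, huK, hφs.lt_iff_lt.1 hcu, hφs.lt_iff_lt.1 hud⟩
  · simpa [hφ] using hp
  · simpa [hφ] using hq
  · intro a ha b hb hab hdis
    obtain ⟨h₁, h₂, H⟩ := hgap (φ a) ha (φ b) hb (hφI a).1 (hφs hab) (hφI b).2 (by
      refine disjoint_left.2 fun u hu huK => ?_
      obtain ⟨s, rfl⟩ := hsurj u ⟨(hφI a).1.trans hu.1.le, hu.2.le.trans (hφI b).2⟩
      exact disjoint_left.1 hdis ⟨hφs.lt_iff_lt.1 hu.1, hφs.lt_iff_lt.1 hu.2⟩ huK)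
    have hcomb : ∀ s, φ (Icc.convexComb a b s) = Icc.convexComb (φ a) (φ b) s := fun s => by
      ext
      simp only [hφ, Icc.coe_convexComb]
      ring
    refine ⟨h₁, h₂, ?_⟩
    -- The endpoints agree definitionally; the ascription lets the paths be compared without casts.
    let P : Path (α (φ a)) (α (φ b)) := α'.subpath a b
    let Q : Path (α (φ a)) (α (φ b)) := (β'.subpath a b).cast h₁ h₂
    have hP : P = α.subpath (φ a) (φ b) := Path.ext (funext fun s => congrArg α (hcomb s))
    have hQ : Q = (β.subpath (φ a) (φ b)).cast h₁ h₂ :=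
      Path.ext (funext fun s => congrArg β (hcomb s))
    have H' : P.Homotopic Q := by rwa [hP, hQ]
    exact H'

lemma HasTransfinitePi1Products.homotopic_of_isHomotopyCutSet (hX : HasTransfinitePi1Products X)
    (hS : IsScattered (algebraicWildSet X)) (hA : IsHomotopyCutSet α β A) : α.Homotopic β := by
  let r : I → I → Prop := α.HomotopicBetween β
  have hrefl : ∀ a ∈ A, r a a := fun a ha => .refl (hA.eq_on a ha)
  have hcl : ∀ s ∈ A, IsClosed {t ∈ A | r s t} := fun s _ =>
    hX.isClosed_setOf_homotopicBetween hA.isClosed hA.eq_on s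
  let B : Set I := {t ∈ A | ¬ ∀ᶠ u in 𝓝 t, u ∈ A → r t u}
  have hBA : B ⊆ A := fun t ht => ht.1
  have hBcl : IsClosed B := by
    have : IsOpen {t | ∀ᶠ u in 𝓝 t, u ∈ A → u ∉ B} := isOpen_setOfPred_eventually_nhds
    convert this.isClosed_compl.inter hA.isClosed using 1
    ext t
    refine ⟨fun ht => ⟨fun h => h.self_of_nhds ht.1 ht, ht.1⟩,
      fun ⟨h, htA⟩ => ⟨htA, fun hg => h ?_⟩⟩
    -- A class that is a neighborhood of `t` in `A` is one of each nearby point too.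
    filter_upwards [hg.eventually_nhds] with s hs hsA hsB
    refine hsB.2 ?_
    have hts := hs.self_of_nhds hsA
    filter_upwards [hs] with u hu huA
    exact hts.symm.trans (hu huA)
  have hgood : ∀ m ∈ A, m ∉ B → ∀ᶠ u in 𝓝 m, u ∈ A → r m u := fun m hm hB => by
    by_contra h
    exact hB ⟨hm, h⟩
  have hgap : ∀ p ∈ A, ∀ q ∈ A, p ≤ q → Disjoint (Ioo p q) B → r p q := by
    intro p hp q hq hpq hdis
    rcases hpq.eq_or_lt with rfl | hpq
    · exact hrefl p hp
    · exact rel_of_forall_mem_Ioo hA.isClosed hrefl (fun _ _ h => h.symm)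
        (fun _ _ _ h h' => h.trans h') (fun a ha b hb => hA.homotopicBetween ha hb) hcl hp hq hpq
        fun m hm h₁ h₂ => hgood m hm (disjoint_left.1 hdis ⟨h₁, h₂⟩)
  suffices hB : B = ∅ from
    (hgap 0 hA.zero_mem 1 hA.one_mem zero_le_one (by simp [hB])).homotopic
  by_contra hne
  obtain ⟨_, ⟨t, htB, rfl⟩, U, hU, hUB⟩ := hS (α '' B)
    (by
      rintro _ ⟨t, ht, rfl⟩
      by_contra hw
      exact ht.2 (eventually_homotopicBetween_of_notMem_algebraicWildSet hA.eq_on ht.1 hw))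
    ((nonempty_iff_ne_empty.2 hne).image α)
  have htU : α t ∈ U := (hUB.ge rfl).1
  have hconst : ∀ s ∈ B, α s ∈ U → α s = α t := fun s hs hsU => hUB.le ⟨hsU, s, hs, rfl⟩
  have hr : ∀ u ∈ A, ∀ v ∈ A, u ≤ v → α '' Icc u v ⊆ U → r u v := by
    intro u hu v hv huv hsub
    rw [image_subset_iff] at hsub
    have hK : IsCompact (B ∩ Icc u v) := (hBcl.inter isClosed_Icc).isCompact
    rcases (B ∩ Icc u v).eq_empty_or_nonempty with h0 | h0
    · exact hgap u hu v hv huv (disjoint_left.2 fun s hs hsB =>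
        h0.le ⟨hsB, Ioo_subset_Icc_self hs⟩)
    -- Only the stretch between the first and last points of `B` in `[u, v]` needs the `π₁`
    -- hypothesis; outside it there is no bad point.
    obtain ⟨a, ⟨haB, ha⟩, hmin⟩ := hK.exists_isLeast h0
    obtain ⟨b, ⟨hbB, hb⟩, hmax⟩ := hK.exists_isGreatest h0
    have hua : r u a := hgap u hu a haB.1 ha.1 (disjoint_left.2 fun s hs hsB =>
      (hmin ⟨hsB, hs.1.le, hs.2.le.trans ha.2⟩).not_gt hs.2)
    have hbv : r b v := hgap b hbB.1 v hv hb.2 (disjoint_left.2 fun s hs hsB =>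
      (hmax ⟨hsB, hb.1.trans hs.1.le, hs.2.le⟩).not_gt hs.1)
    refine (hua.trans ?_).trans hbv
    rcases (hmin ⟨hbB, hb⟩).eq_or_lt with rfl | hab
    · exact hrefl a haB.1
    refine hX.homotopicBetween_of_const hBcl (fun c d hcd => ?_) hab haB hbB (fun s hsB hs => ?_)
      (fun s hs => hA.eq_on s hs.1)
      (fun c hc d hd _ hcd _ hdis => hgap c hc.1 d hd.1 hcd.le hdis)
    · obtain ⟨w, hw, h⟩ := hA.exists_between_notMem hcd
      exact ⟨w, fun h => hw h.1, h⟩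
    · rw [hconst s hsB (hsub ⟨ha.1.trans hs.1, hs.2.trans hb.2⟩), hconst a haB (hsub ha)]
  refine htB.2 ?_
  have hI : Tendsto (fun u => uIcc t u) (𝓝 t) (𝓝 t).smallSets :=
    tendsto_const_nhds.uIcc tendsto_id
  filter_upwards [tendsto_smallSets_iff.1 hI _
    (α.continuous.continuousAt (hU.mem_nhds htU))] with u hu huA
  rcases le_total t u with h | h
  · rw [uIcc_of_le h] at hu
    exact hr t htB.1 u huA h (image_subset_iff.2 hu)
  · rw [uIcc_of_ge h] at hu
    exact (hr u huA t htB.1 h (image_subset_iff.2 hu)).symm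

end Reduction

theorem theorem1p1 (X : Type*) [TopologicalSpace X] (hX : IsScattered (algebraicWildSet X)) :
    HasTransfinitePi1Products X ↔ HasTransfiniteGroupoidProducts X :=
  ⟨fun h _ _ _ _ _ hA => h.homotopic_of_isHomotopyCutSet hX hA,
    fun h x α β A _ _ hA => h x x α β A hA⟩
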